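/- Theorem 5. A pure maximally entangled state of $k\ge 1$ qubits held by $k$ distinct agents, one qubit each, is a state $(U_1\otimes\cdots\otimes U_k)\,(|0\cdots 0\rangle+|1\cdots 1\rangle)/\sqrt2$ with single-qubit unitaries $U_1,\dots,U_k$. Let $n\ge 2$, let $S$ be a set of $n$ agents, and let $E_1,\dots,E_m$ be nonempty subsets of $S$ (hyperedges). Suppose that, for each $i$, the agents in $E_i$ share a pure $|E_i|$-partite maximally entangled state on qubits set aside for $E_i$ (one qubit per agent of $E_i$), and that the initial joint state of all agents is the tensor product of these $m$ states (an entangled hypergraph). Call the hypergraph $H=(S,\{E_1,\dots,E_m\})$ connected if for all agents $a,b\in S$ there is a hyperpath from $a$ to $b$, that is, a sequence of $j\ge 1$ hyperedges, consecutive ones having a common agent, the first containing $a$ and the last containing $b$. Then a pure $n$-partite maximally entangled state, with one qubit for each agent of $S$, can be prepared from the initial state, exactly and with certainty, by a finite protocol of local quantum operations and classical communication (LOCC) if and only if $H$ is connected. More precisely, this equivalence holds for each pure $n$-partite maximally entangled state as the target. -/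

import Mathlib

open scoped BigOperators Matrix

noncomputable section

/-- A finite-dimensional quantum system, given by its finite set of computational basis labels. -/
structure QSystem : Type 1 where
  /-- the labels of the computational basis -/
  Label : Type
  [fintype : Fintype Label]
  [decEq : DecidableEq Label]

attribute [instance] QSystem.fintype QSystem.decEq

/-- The basis labels of the joint system of the agents `S`, agent `a` holding `d a`;
the joint space is the tensor product of the spaces `d a`. -/
abbrev Joint {S : Type} (d : S → QSystem) : Type := (a : S) → (d a).Label

/-- The tensor product `⨂ a, A a` of one local operator for each agent. -/
def tensorOp {S : Type} [Fintype S] {d d' : S → QSystem}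
    (A : (a : S) → Matrix (d' a).Label (d a).Label ℂ) : Matrix (Joint d') (Joint d) ℂ :=
  Matrix.of fun y x => ∏ a, A a (y a) (x a)

/-- The density matrix `|ψ⟩⟨ψ|` of a state vector. -/
def pureDensity {X : Type} (ψ : X → ℂ) : Matrix X X ℂ :=
  Matrix.vecMulVec ψ (star ψ)

/-- A quantum instrument from `A` to `B` with finitely many classical outcomes: the most general
operation on one system. If the outcome is `o`, then `ρ` becomes the unnormalised state
`∑ r, K o r * ρ * (K o r)ᴴ`, whose trace is the probability of `o`. -/
structure Instrument (A B : QSystem) where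
  /-- the number of classical outcomes -/
  outcomes : ℕ
  /-- the number of Kraus operators for each outcome -/
  env : ℕ
  /-- the Kraus operators -/
  kraus : Fin outcomes → Fin env → Matrix B.Label A.Label ℂ
  complete : ∑ o, ∑ r, (kraus o r)ᴴ * kraus o r = 1

/-- A finite protocol of local operations and classical communication between the agents `S`,
with final systems `e`; the index is the family of systems the agents hold at the start.
In a round each agent applies an instrument to its own system (an idle agent uses the identity)
and broadcasts its outcome; how the agents continue depends on all outcomes so far. -/
inductive LOCC {S : Type} (e : S → QSystem) : (S → QSystem) → Type 1
  | done : LOCC e e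
  | round {d d' : S → QSystem} (I : (a : S) → Instrument (d a) (d' a))
      (next : ((a : S) → Fin (I a).outcomes) → LOCC e d') : LOCC e d

/-- The unnormalised joint state after a round in which agent `a` applies `I a`
and obtains the outcome `o a`. -/
def roundState {S : Type} [Fintype S] [DecidableEq S] {d d' : S → QSystem}
    (I : (a : S) → Instrument (d a) (d' a)) (o : (a : S) → Fin (I a).outcomes)
    (ρ : Matrix (Joint d) (Joint d) ℂ) : Matrix (Joint d') (Joint d') ℂ :=
  ∑ r : (a : S) → Fin (I a).env,
    tensorOp (fun a => (I a).kraus (o a) (r a)) * ρ *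
      (tensorOp (fun a => (I a).kraus (o a) (r a)))ᴴ

/-- The final state of a protocol (averaged over all outcomes) on the initial state `ρ`. -/
def LOCC.run {S : Type} [Fintype S] [DecidableEq S] {e : S → QSystem} :
    {d : S → QSystem} → LOCC e d → Matrix (Joint d) (Joint d) ℂ → Matrix (Joint e) (Joint e) ℂ
  | _, .done, ρ => ρ
  | _, .round I next, ρ => ∑ o, (next o).run (roundState I o ρ)

/-- The pure state `φ` can be prepared from the pure state `ψ` by LOCC: some finite LOCC protocol
with input `ψ` has output exactly `φ`, with certainty. -/
def CanPrepare {S : Type} [Fintype S] [DecidableEq S] {d e : S → QSystem}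
    (ψ : Joint d → ℂ) (φ : Joint e → ℂ) : Prop :=
  ∃ P : LOCC e d, P.run (pureDensity ψ) = pureDensity φ

/-- A single qubit. -/
abbrev qubit : QSystem := ⟨Fin 2⟩

/-- The state `(|0…0⟩ + |1…1⟩) / √2` of one qubit for each party in `P`. -/
def ghz (P : Type) [Fintype P] : (P → Fin 2) → ℂ :=
  (1 / (Real.sqrt 2 : ℂ)) • (Pi.single (fun _ => 0) 1 + Pi.single (fun _ => 1) 1)

/-- A pure maximally entangled state of one qubit for each party in `P`: the image of
`(|0…0⟩ + |1…1⟩) / √2` under a unitary change of basis of each qubit. -/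
def IsMaxEntangled {P : Type} [Fintype P] [DecidableEq P] (ψ : (P → Fin 2) → ℂ) : Prop :=
  ∃ U : P → Matrix.unitaryGroup (Fin 2) ℂ,
    ψ = tensorOp (d := fun _ : P => qubit) (d' := fun _ : P => qubit)
      (fun p => (U p : Matrix (Fin 2) (Fin 2) ℂ)) *ᵥ ghz P

section Hypergraph

variable {S : Type} [DecidableEq S] {m : ℕ}

/-- There is a hyperpath from `a` to `b` in the hypergraph with hyperedges `E 0, …, E (m - 1)`:
a sequence of hyperedges, successive ones having a common vertex, the first containing `a`
and the last containing `b`. -/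
def HasHyperpath (E : Fin m → Finset S) (a b : S) : Prop :=
  ∃ (j : ℕ) (e : Fin (j + 1) → Fin m),
    (∀ i : Fin j, (E (e i.castSucc) ∩ E (e i.succ)).Nonempty) ∧
      a ∈ E (e 0) ∧ b ∈ E (e (Fin.last j))

/-- Every pair of vertices is joined by a hyperpath. -/
def HypergraphConnected (E : Fin m → Finset S) : Prop :=
  ∀ a b : S, HasHyperpath E a b

/-- The qubits that agent `a` holds in the entangled hypergraph: one for each hyperedge
that contains `a`. -/
abbrev heldQubits (E : Fin m → Finset S) (a : S) : QSystem :=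
  ⟨{i : Fin m // a ∈ E i} → Fin 2⟩

/-- The joint state of an entangled hypergraph: the tensor product of the states `φ i`,
where `φ i` is shared by the agents in `E i`. -/
def hypergraphState [Fintype S] (E : Fin m → Finset S)
    (φ : (i : Fin m) → ({a // a ∈ E i} → Fin 2) → ℂ) :
    Joint (heldQubits E) → ℂ :=
  fun x => ∏ i, φ i (fun a => x a.1 ⟨i, a.2⟩)

end Hypergraph

end

/-! Necessity: if the hypergraph is disconnected, no hyperedge crosses some nontrivial cut, so the
initial state is a product across it. LOCC preserves the cone generated by such pure product states
(`LOCC.run_mem`, `tensorOp_conj_mem_cutSeparable`), and a pure state in this cone is itself a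
product (`isCutProduct_of_pureDensity_mem`), which a maximally entangled state is not.

Sufficiency: once the local bases are undone, the state is a uniform superposition over one bit per
hyperedge, copied to all its agents. Each agent measures the relative parities of its own bits and
keeps one qubit for the remaining common flip. The outcomes fix the relative parity of any two
hyperedges that meet, so connectivity determines all bits up to one global flip. What is left is a
GHZ state up to known bit flips (`exists_bitFlip_eq_smul_ghz`). The outcome probabilities are never
computed: `LOCC.trace_run` forces them to sum to one. -/

/-! ### Algebra of local operators. -/

section TensorOp

variable {S : Type} [Fintype S] {d d' d'' : S → QSystem}

theorem tensorOp_conjTranspose (A : (a : S) → Matrix (d' a).Label (d a).Label ℂ) :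
    (tensorOp A)ᴴ = tensorOp fun a => (A a)ᴴ := by
  ext x y
  simp [tensorOp, Matrix.conjTranspose_apply]

theorem tensorOp_one : tensorOp (fun a => (1 : Matrix (d a).Label (d a).Label ℂ)) = 1 := by
  ext x y
  simp only [tensorOp, Matrix.of_apply, Matrix.one_apply, Finset.prod_boole, Finset.mem_univ,
    true_imp_iff, funext_iff]

variable [DecidableEq S]

theorem tensorOp_mul (A : (a : S) → Matrix (d'' a).Label (d' a).Label ℂ)
    (B : (a : S) → Matrix (d' a).Label (d a).Label ℂ) :
    tensorOp A * tensorOp B = tensorOp fun a => A a * B a := by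
  ext x y
  simp only [Matrix.mul_apply, tensorOp, Matrix.of_apply, ← Finset.prod_mul_distrib]
  rw [Finset.prod_univ_sum, Fintype.piFinset_univ]

theorem tensorOp_sum {ι : S → Type} [∀ a, Fintype (ι a)]
    (A : (a : S) → ι a → Matrix (d' a).Label (d a).Label ℂ) :
    ∑ r : (a : S) → ι a, tensorOp (fun a => A a (r a)) = tensorOp fun a => ∑ r, A a r := by
  ext x y
  simp only [tensorOp, Matrix.sum_apply, Matrix.of_apply]
  rw [Finset.prod_univ_sum, Fintype.piFinset_univ]

/-- A tensor product of isometries is an isometry. -/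
theorem tensorOp_isometry {A : (a : S) → Matrix (d' a).Label (d a).Label ℂ}
    (hA : ∀ a, (A a)ᴴ * A a = 1) : (tensorOp A)ᴴ * tensorOp A = 1 := by
  rw [tensorOp_conjTranspose, tensorOp_mul, funext hA, tensorOp_one]

end TensorOp

/-! ### Rank-one density matrices. -/

section PureDensity

variable {X Y : Type} [Fintype X]

theorem mul_pureDensity_mul_conjTranspose (M : Matrix Y X ℂ) (v : X → ℂ) :
    M * pureDensity v * Mᴴ = pureDensity (M *ᵥ v) := by
  rw [pureDensity, pureDensity, Matrix.mul_vecMulVec, Matrix.vecMulVec_mul, Matrix.star_mulVec]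

theorem pureDensity_smul (c : ℂ) (v : Y → ℂ) :
    pureDensity (c • v) = (c * star c) • pureDensity v := by
  ext x y
  simp [pureDensity, Matrix.vecMulVec_apply]
  ring

theorem trace_pureDensity (v : X → ℂ) : (pureDensity v).trace = v ⬝ᵥ star v :=
  Matrix.trace_vecMulVec _ _

theorem trace_pureDensity_mulVec [DecidableEq X] [Fintype Y] {M : Matrix Y X ℂ} (hM : Mᴴ * M = 1)
    (v : X → ℂ) : (pureDensity (M *ᵥ v)).trace = (pureDensity v).trace := by
  rw [← mul_pureDensity_mul_conjTranspose, Matrix.trace_mul_comm, ← Matrix.mul_assoc, hM,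
    Matrix.one_mul]

end PureDensity

/-! ### General properties of protocols. -/

section Runs

variable {S : Type} [Fintype S] [DecidableEq S] {d d' e : S → QSystem}

/-- By multilinearity, summing the tensor products over all outcomes and Kraus indices gives the
tensor product of the agents' completeness sums, which is the identity. -/
theorem sum_trace_roundState (I : (a : S) → Instrument (d a) (d' a))
    (ρ : Matrix (Joint d) (Joint d) ℂ) :
    ∑ o, (roundState I o ρ).trace = ρ.trace := by
  have key : ∑ o : (a : S) → Fin (I a).outcomes, ∑ r : (a : S) → Fin (I a).env,
      (tensorOp (fun a => (I a).kraus (o a) (r a)))ᴴ *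
        tensorOp (fun a => (I a).kraus (o a) (r a)) = 1 := by
    simp only [tensorOp_conjTranspose, tensorOp_mul]
    have h (o : (a : S) → Fin (I a).outcomes) := tensorOp_sum (d := d) (d' := d)
      (fun (a : S) (r : Fin (I a).env) => ((I a).kraus (o a) r)ᴴ * (I a).kraus (o a) r)
    simp only [h]
    rw [tensorOp_sum (d := d) (d' := d) (fun (a : S) (o : Fin (I a).outcomes) =>
      ∑ r, ((I a).kraus o r)ᴴ * (I a).kraus o r)]
    simp only [(I _).complete]
    exact tensorOp_one
  calc ∑ o, (roundState I o ρ).trace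
      = ∑ o : (a : S) → Fin (I a).outcomes, ∑ r : (a : S) → Fin (I a).env,
      (((tensorOp (fun a => (I a).kraus (o a) (r a)))ᴴ *
        tensorOp (fun a => (I a).kraus (o a) (r a))) * ρ).trace := by
        refine Finset.sum_congr rfl fun o _ => ?_
        rw [roundState, Matrix.trace_sum]
        refine Finset.sum_congr rfl fun r _ => ?_
        rw [Matrix.trace_mul_comm, ← Matrix.mul_assoc]
    _ = ρ.trace := by
        simp only [← Matrix.trace_sum, ← Finset.sum_mul]
        rw [key, Matrix.one_mul]

/-- Protocols preserve the trace. -/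
theorem LOCC.trace_run (P : LOCC e d) (ρ : Matrix (Joint d) (Joint d) ℂ) :
    (P.run ρ).trace = ρ.trace := by
  induction P with
  | done => rfl
  | round I next ih =>
    rw [LOCC.run, Matrix.trace_sum]
    simp only [ih]
    exact sum_trace_roundState I ρ

/-- If a set of unnormalised states is closed under addition and under local Kraus operators,
then every protocol maps it to the corresponding set. -/
theorem LOCC.run_mem (C : (d : S → QSystem) → AddSubmonoid (Matrix (Joint d) (Joint d) ℂ))
    (hC : ∀ (d d' : S → QSystem) (A : (a : S) → Matrix (d' a).Label (d a).Label ℂ),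
      ∀ ρ ∈ C d, tensorOp A * ρ * (tensorOp A)ᴴ ∈ C d')
    (P : LOCC e d) {ρ : Matrix (Joint d) (Joint d) ℂ} (hρ : ρ ∈ C d) : P.run ρ ∈ C e := by
  induction P with
  | done => exact hρ
  | round I next ih =>
    exact sum_mem fun o _ => ih o (sum_mem fun r _ => hC _ _ _ _ hρ)

/-- The instrument with a single outcome given by an isometry. -/
def Instrument.ofIsometry {A B : QSystem} (V : Matrix B.Label A.Label ℂ) (hV : Vᴴ * V = 1) :
    Instrument A B where
  outcomes := 1
  env := 1
  kraus _ _ := V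
  complete := by simpa using hV

/-- First every agent applies an isometry. -/
def LOCC.isometryThen (V : (a : S) → Matrix (d' a).Label (d a).Label ℂ)
    (hV : ∀ a, (V a)ᴴ * V a = 1) (P : LOCC e d') : LOCC e d :=
  .round (fun a => Instrument.ofIsometry (V a) (hV a)) fun _ => P

theorem LOCC.run_isometryThen (V : (a : S) → Matrix (d' a).Label (d a).Label ℂ)
    (hV : ∀ a, (V a)ᴴ * V a = 1) (P : LOCC e d') (v : Joint d → ℂ) :
    (P.isometryThen V hV).run (pureDensity v) = P.run (pureDensity (tensorOp V *ᵥ v)) := by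
  have h (o) : roundState (fun a => Instrument.ofIsometry (V a) (hV a)) o (pureDensity v) =
      pureDensity (tensorOp V *ᵥ v) := by
    rw [← mul_pureDensity_mul_conjTranspose]
    exact Fintype.sum_unique (ι := (a : S) → Fin 1) _
  rw [LOCC.isometryThen, LOCC.run]
  simp only [h]
  exact Fintype.sum_unique (ι := (a : S) → Fin 1) _

end Runs

/-! ### Normalisation of maximally entangled states. -/

section MaxEntangled

theorem ghz_apply {P : Type} [Fintype P] [DecidableEq P] (z : P → Fin 2) :
    ghz P z = ∑ b : Fin 2, (1 / (Real.sqrt 2 : ℂ)) * if z = fun _ => b then 1 else 0 := by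
  simp [ghz, Pi.single_apply, mul_add]

theorem inv_sqrt_two_mul_self : (1 / (Real.sqrt 2 : ℂ)) * (1 / (Real.sqrt 2 : ℂ)) = 1 / 2 := by
  rw [div_mul_div_comm, ← Complex.ofReal_mul, Real.mul_self_sqrt (by norm_num)]
  norm_num

theorem inv_sqrt_two_ne_zero : (1 / (Real.sqrt 2 : ℂ)) ≠ 0 := by
  simp

variable {P : Type} [Fintype P] [DecidableEq P]

theorem trace_pureDensity_ghz [Nonempty P] : (pureDensity (ghz P)).trace = 1 := by
  have h0 : (fun _ : P => (0 : Fin 2)) ≠ fun _ => 1 := by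
    intro h
    simpa using congrFun h (Classical.arbitrary P)
  have h : ∀ z, ghz P z * star (ghz P z) =
      (if z = fun _ => 0 then 1 / 2 else 0) + if z = fun _ => 1 then 1 / 2 else 0 := by
    intro z
    have hs : star (1 / (Real.sqrt 2 : ℂ)) = 1 / (Real.sqrt 2 : ℂ) := by simp
    rw [ghz_apply, Fin.sum_univ_two]
    by_cases hz : z = fun _ => 0
    · subst hz
      simp only [if_neg h0, if_true, mul_one, mul_zero, add_zero, hs, inv_sqrt_two_mul_self]
    · by_cases hz' : z = fun _ => 1
      · subst hz'
        simp only [if_neg h0.symm, if_true, mul_one, mul_zero, zero_add, hs,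
          inv_sqrt_two_mul_self]
      · simp [hz, hz']
  rw [trace_pureDensity, dotProduct]
  simp only [Pi.star_apply, h, Finset.sum_add_distrib, Finset.sum_ite_eq', Finset.mem_univ,
    if_true]
  norm_num

theorem unitary_conjTranspose_mul_self (U : Matrix.unitaryGroup (Fin 2) ℂ) :
    (U : Matrix (Fin 2) (Fin 2) ℂ)ᴴ * (U : Matrix (Fin 2) (Fin 2) ℂ) = 1 :=
  Matrix.mem_unitaryGroup_iff'.1 U.2

theorem unitary_mul_conjTranspose_self (U : Matrix.unitaryGroup (Fin 2) ℂ) :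
    (U : Matrix (Fin 2) (Fin 2) ℂ) * (U : Matrix (Fin 2) (Fin 2) ℂ)ᴴ = 1 :=
  Matrix.mem_unitaryGroup_iff.1 U.2

theorem trace_pureDensity_of_isMaxEntangled [Nonempty P] {ψ : (P → Fin 2) → ℂ}
    (hψ : IsMaxEntangled ψ) : (pureDensity ψ).trace = 1 := by
  obtain ⟨U, rfl⟩ := hψ
  exact (trace_pureDensity_mulVec (tensorOp_isometry (d := fun _ : P => qubit)
    (d' := fun _ : P => qubit) fun p => unitary_conjTranspose_mul_self (U p)) _).trans
    trace_pureDensity_ghz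

end MaxEntangled

/-! ### Necessity: separability across a cut. -/

section CutProduct

open scoped ComplexOrder

variable {S : Type} [DecidableEq S] {d d' : S → QSystem}

/-- The vector `v` is a product across the cut between `A` and its complement: exchanging the
labels of the agents in `A` between two basis states does not change the product of amplitudes. -/
def IsCutProduct (A : Finset S) (v : Joint d → ℂ) : Prop :=
  ∀ x y, v x * v y = v (A.piecewise x y) * v (A.piecewise y x)

/-- Exchanging the labels of the agents in `A` between two basis states. -/
def cutSwap (A : Finset S) (d : S → QSystem) : (Joint d × Joint d) ≃ (Joint d × Joint d) where
  toFun p := (A.piecewise p.1 p.2, A.piecewise p.2 p.1)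
  invFun p := (A.piecewise p.1 p.2, A.piecewise p.2 p.1)
  left_inv p := by ext a <;> by_cases h : a ∈ A <;> simp [h]
  right_inv p := by ext a <;> by_cases h : a ∈ A <;> simp [h]

variable [Fintype S]

/-- A product of two output amplitudes is a sum over pairs of input basis states. Reindexing the
pairs by `cutSwap` only permutes the two matrix entries belonging to each agent in `A`. -/
theorem IsCutProduct.tensorOp_mulVec {A : Finset S} {v : Joint d → ℂ} (hv : IsCutProduct A v)
    (M : (a : S) → Matrix (d' a).Label (d a).Label ℂ) : IsCutProduct A (tensorOp M *ᵥ v) := by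
  intro x y
  have expand (x y : Joint d') : (tensorOp M *ᵥ v) x * (tensorOp M *ᵥ v) y =
      ∑ p : Joint d × Joint d,
        (∏ a, M a (x a) (p.1 a) * M a (y a) (p.2 a)) * (v p.1 * v p.2) := by
    simp only [Matrix.mulVec, dotProduct, tensorOp, Matrix.of_apply]
    rw [Finset.sum_mul_sum, Fintype.sum_prod_type]
    refine Finset.sum_congr rfl fun p _ => Finset.sum_congr rfl fun q _ => ?_
    rw [Finset.prod_mul_distrib]
    ring
  rw [expand, expand]
  refine Fintype.sum_equiv (cutSwap A d) _ _ fun p => ?_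
  simp only [cutSwap, Equiv.coe_fn_mk]
  rw [← hv p.1 p.2]
  congr 1
  refine Finset.prod_congr rfl fun a _ => ?_
  by_cases h : a ∈ A
  · simp [h]
  · simp [h, mul_comm]

/-- The unnormalised states that are separable across the cut between `A` and its complement. -/
def cutSeparable (A : Finset S) (d : S → QSystem) : AddSubmonoid (Matrix (Joint d) (Joint d) ℂ) :=
  AddSubmonoid.closure {ρ | ∃ v : Joint d → ℂ, IsCutProduct A v ∧ ρ = pureDensity v}

theorem tensorOp_conj_mem_cutSeparable {A : Finset S}
    (M : (a : S) → Matrix (d' a).Label (d a).Label ℂ) {ρ : Matrix (Joint d) (Joint d) ℂ}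
    (hρ : ρ ∈ cutSeparable A d) : tensorOp M * ρ * (tensorOp M)ᴴ ∈ cutSeparable A d' := by
  induction hρ using AddSubmonoid.closure_induction with
  | mem ρ h =>
    obtain ⟨v, hv, rfl⟩ := h
    rw [mul_pureDensity_mul_conjTranspose]
    exact AddSubmonoid.subset_closure ⟨_, hv.tensorOp_mulVec M, rfl⟩
  | zero => simp
  | add ρ σ _ _ h h' =>
    rw [Matrix.mul_add, Matrix.add_mul]
    exact add_mem h h'

theorem posSemidef_of_mem_cutSeparable {A : Finset S} {ρ : Matrix (Joint d) (Joint d) ℂ}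
    (hρ : ρ ∈ cutSeparable A d) : ρ.PosSemidef := by
  induction hρ using AddSubmonoid.closure_induction with
  | mem ρ h =>
    obtain ⟨v, -, rfl⟩ := h
    exact Matrix.posSemidef_vecMulVec_self_star v
  | zero => exact Matrix.PosSemidef.zero
  | add ρ σ _ _ h h' => exact h.add h'

/-- One nonzero product term suffices to identify a pure state, so positivity is all that is
retained of the other terms. -/
theorem eq_zero_or_exists_of_mem_cutSeparable {A : Finset S} {ρ : Matrix (Joint d) (Joint d) ℂ}
    (hρ : ρ ∈ cutSeparable A d) :
    ρ = 0 ∨ ∃ v : Joint d → ℂ, v ≠ 0 ∧ IsCutProduct A v ∧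
      ∃ σ : Matrix (Joint d) (Joint d) ℂ, σ.PosSemidef ∧ ρ = pureDensity v + σ := by
  induction hρ using AddSubmonoid.closure_induction with
  | mem ρ h =>
    obtain ⟨v, hv, rfl⟩ := h
    by_cases h0 : v = 0
    · left
      ext
      simp [h0, pureDensity, Matrix.vecMulVec_apply]
    · exact .inr ⟨v, h0, hv, 0, Matrix.PosSemidef.zero, (add_zero _).symm⟩
  | zero => exact .inl rfl
  | add ρ σ _ hσ h h' =>
    rcases h with rfl | ⟨v, h0, hv, τ, hτ, rfl⟩
    · simpa using h'
    · exact .inr ⟨v, h0, hv, τ + σ, hτ.add (posSemidef_of_mem_cutSeparable hσ), add_assoc _ _ _⟩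

theorem star_dotProduct_pureDensity_mulVec {X : Type} [Fintype X] (w v : X → ℂ) :
    star w ⬝ᵥ (pureDensity v *ᵥ w) = (star w ⬝ᵥ v) * star (star w ⬝ᵥ v) := by
  rw [pureDensity, Matrix.vecMulVec_mulVec, dotProduct_smul, ← Matrix.star_dotProduct]
  rfl

/-- In a decomposition of a pure state, every pure term is proportional to the state. -/
theorem mul_eq_mul_of_pureDensity_eq_add {X : Type} [Fintype X] [DecidableEq X] {ψ v : X → ℂ}
    {σ : Matrix X X ℂ} (hσ : σ.PosSemidef) (h : pureDensity ψ = pureDensity v + σ) (x y : X) :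
    ψ y * v x = ψ x * v y := by
  -- This vector is orthogonal to `ψ`, so the two nonnegative quadratic forms on the right sum to
  -- zero at `w` and both vanish.
  set w : X → ℂ := star (ψ y) • Pi.single x 1 - star (ψ x) • Pi.single y 1 with hw
  have hstar (u : X → ℂ) : star w ⬝ᵥ u = ψ y * u x - ψ x * u y := by
    simp [hw, sub_dotProduct]
  have h1 := congrArg (fun M => star w ⬝ᵥ (M *ᵥ w)) h
  simp only [Matrix.add_mulVec, dotProduct_add, star_dotProduct_pureDensity_mulVec] at h1
  rw [hstar ψ, mul_comm (ψ x), sub_self, zero_mul] at h1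
  have h2 : 0 ≤ star w ⬝ᵥ (σ *ᵥ w) := hσ.dotProduct_mulVec_nonneg w
  have h3 : 0 ≤ (star w ⬝ᵥ v) * star (star w ⬝ᵥ v) := mul_star_self_nonneg _
  have h4 := ((add_eq_zero_iff_of_nonneg h3 h2).1 h1.symm).1
  rw [mul_eq_zero, star_eq_zero, or_self, hstar] at h4
  exact sub_eq_zero.1 h4

theorem isCutProduct_of_pureDensity_mem {A : Finset S} {ψ : Joint d → ℂ}
    (h : pureDensity ψ ∈ cutSeparable A d) : IsCutProduct A ψ := by
  by_cases h0 : ψ = 0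
  · intro x y
    simp [h0]
  obtain ⟨z, hz⟩ := Function.ne_iff.1 h0
  rw [Pi.zero_apply] at hz
  rcases eq_zero_or_exists_of_mem_cutSeparable h with h | ⟨v, hv0, hv, σ, hσ, h⟩
  · have := congrFun (congrFun h z) z
    simp [pureDensity, Matrix.vecMulVec_apply, hz] at this
  · have hprop := mul_eq_mul_of_pureDensity_eq_add hσ h
    have hvz : v z ≠ 0 := by
      intro hvz
      refine hv0 (funext fun x => ?_)
      have := hprop x z
      rw [hvz, mul_zero] at this
      exact (mul_eq_zero.1 this).resolve_left hz
    intro x y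
    have key := hv x y
    have e (x) : ψ x = ψ z / v z * v x := by
      rw [div_mul_eq_mul_div, eq_div_iff hvz, hprop]
    rw [e x, e y, e (A.piecewise x y), e (A.piecewise y x)]
    linear_combination (ψ z / v z) ^ 2 * key

/-- A state that is a product across a cut cannot be turned into one that is not. -/
theorem CanPrepare.isCutProduct {e : S → QSystem} {A : Finset S} {ψ : Joint d → ℂ}
    {φ : Joint e → ℂ} (h : CanPrepare ψ φ) (hψ : IsCutProduct A ψ) : IsCutProduct A φ := by
  obtain ⟨P, hP⟩ := h
  refine isCutProduct_of_pureDensity_mem ?_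
  rw [← hP]
  exact P.run_mem (cutSeparable A) (fun _ _ M _ hρ => tensorOp_conj_mem_cutSeparable M hρ)
    (AddSubmonoid.subset_closure ⟨ψ, hψ, rfl⟩)

/-- A maximally entangled state is not a product across a nontrivial cut. -/
theorem IsMaxEntangled.not_isCutProduct {ψ : (S → Fin 2) → ℂ} (hψ : IsMaxEntangled ψ)
    {A : Finset S} {a b : S} (ha : a ∈ A) (hb : b ∉ A) :
    ¬ IsCutProduct (d := fun _ : S => qubit) A ψ := by
  obtain ⟨U, rfl⟩ := hψ
  intro h
  have h' := h.tensorOp_mulVec (d' := fun _ : S => qubit)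
    fun p => (U p : Matrix (Fin 2) (Fin 2) ℂ)ᴴ
  rw [Matrix.mulVec_mulVec, ← tensorOp_conjTranspose, tensorOp_isometry
    (d := fun _ : S => qubit) (d' := fun _ : S => qubit)
    fun p => unitary_conjTranspose_mul_self (U p), Matrix.one_mulVec] at h'
  have hne : ∀ c c' : Fin 2, c ≠ c' →
      ghz S (A.piecewise (fun _ => c) fun _ => c') = 0 := by
    intro c c' hc
    rw [ghz_apply]
    refine Finset.sum_eq_zero fun k _ => ?_
    rw [if_neg, mul_zero]
    intro hk
    have h1 := congrFun hk a
    have h2 := congrFun hk b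
    simp only [ha, hb, Finset.piecewise_eq_of_mem, Finset.piecewise_eq_of_notMem,
      not_false_eq_true] at h1 h2
    exact hc (h1.trans h2.symm)
  have hc (c : Fin 2) : ghz S (fun _ => c) = 1 / (Real.sqrt 2 : ℂ) := by
    rw [ghz_apply, Finset.sum_eq_single c]
    · simp
    · intro k _ hk
      rw [if_neg fun h => hk (congrFun h a).symm, mul_zero]
    · simp
  -- Exchanging `A` between the all-zero and all-one strings gives mixed strings of amplitude zero,
  -- whereas the original product is 1/2.
  have key := h' (fun _ => (0 : Fin 2)) fun _ => (1 : Fin 2)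
  rw [hc, hc, inv_sqrt_two_mul_self] at key
  erw [hne 0 1 (by decide)] at key
  simp at key

end CutProduct

/-! ### Cuts of a disconnected hypergraph. -/

section Disconnected

variable {S : Type} [DecidableEq S] {m : ℕ} {E : Fin m → Finset S}

theorem hasHyperpath_of_mem {i : Fin m} {a b : S} (ha : a ∈ E i) (hb : b ∈ E i) :
    HasHyperpath E a b :=
  ⟨0, fun _ => i, fun k => k.elim0, ha, hb⟩

theorem HasHyperpath.trans_mem {i : Fin m} {a b c : S} (h : HasHyperpath E a b) (hb : b ∈ E i)
    (hc : c ∈ E i) : HasHyperpath E a c := by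
  obtain ⟨j, e, he, ha, hl⟩ := h
  refine ⟨j + 1, Fin.snoc e i, ?_, ?_, ?_⟩
  · intro k
    refine Fin.lastCases ?_ (fun k => ?_) k
    · rw [Fin.snoc_castSucc, Fin.succ_last, Fin.snoc_last]
      exact ⟨b, Finset.mem_inter.2 ⟨hl, hb⟩⟩
    · rw [Fin.snoc_castSucc, Fin.succ_castSucc, Fin.snoc_castSucc]
      exact he k
  · rw [← Fin.castSucc_zero, Fin.snoc_castSucc]
    exact ha
  · rwa [Fin.snoc_last]

/-- A disconnected hypergraph has a nontrivial cut crossed by no hyperedge. -/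
theorem exists_cut_of_not_connected [Fintype S] [Nontrivial S] (h : ¬ HypergraphConnected E) :
    ∃ (A : Finset S) (a b : S), a ∈ A ∧ b ∉ A ∧ ∀ i, E i ⊆ A ∨ Disjoint (E i) A := by
  classical
  simp only [HypergraphConnected, not_forall] at h
  obtain ⟨a, b, hab⟩ := h
  -- The disjunct `c = a` matters: an agent in no hyperedge has no hyperpath even to itself.
  let A : Finset S := {c | c = a ∨ HasHyperpath E a c}
  have hA : ∀ i, E i ⊆ A ∨ Disjoint (E i) A := by
    intro i
    refine or_iff_not_imp_right.2 fun hi => ?_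
    obtain ⟨c, hc, hcA⟩ := Finset.not_disjoint_iff.1 hi
    intro c' hc'
    simp only [A, Finset.mem_filter, Finset.mem_univ, true_and] at hcA ⊢
    rcases hcA with rfl | hcA
    · exact .inr (hasHyperpath_of_mem hc hc')
    · exact .inr (hcA.trans_mem hc hc')
  have ha : a ∈ A := by simp [A]
  -- If `b = a`, this agent lies in no hyperedge, so `A` is a singleton and any other agent is
  -- outside it.
  by_cases hba : b = a
  · subst hba
    obtain ⟨c, hc⟩ := exists_ne b
    refine ⟨A, b, c, ha, ?_, hA⟩
    simp only [A, Finset.mem_filter, Finset.mem_univ, true_and, hc, false_or]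
    rintro ⟨j, e, -, hb, -⟩
    exact hab (hasHyperpath_of_mem hb hb)
  · refine ⟨A, a, b, ha, ?_, hA⟩
    simp [A, hba, hab]

theorem isCutProduct_hypergraphState [Fintype S] {A : Finset S}
    (hA : ∀ i, E i ⊆ A ∨ Disjoint (E i) A) (φ : (i : Fin m) → ({a // a ∈ E i} → Fin 2) → ℂ) :
    IsCutProduct A (hypergraphState E φ) := by
  intro x y
  simp only [hypergraphState, ← Finset.prod_mul_distrib]
  refine Finset.prod_congr rfl fun i _ => ?_
  rcases hA i with h | h
  · have e (x y : Joint (heldQubits E)) : (fun a : {a // a ∈ E i} =>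
        A.piecewise x y a.1 ⟨i, a.2⟩) = fun a => x a.1 ⟨i, a.2⟩ :=
      funext fun a => by rw [Finset.piecewise_eq_of_mem _ _ _ (h a.2)]
    rw [e, e]
  · have e (x y : Joint (heldQubits E)) : (fun a : {a // a ∈ E i} =>
        A.piecewise x y a.1 ⟨i, a.2⟩) = fun a => y a.1 ⟨i, a.2⟩ :=
      funext fun a => by
        rw [Finset.piecewise_eq_of_notMem _ _ _ (Finset.disjoint_left.1 h a.2)]
    rw [e, e, mul_comm]

end Disconnected

/-! ### The hypergraph state, regrouped by hyperedges. -/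

section HypergraphState

variable {S : Type} [DecidableEq S] {m : ℕ} {E : Fin m → Finset S}

/-- Regrouping the qubits of all agents by hyperedges. -/
def regroupQubits (E : Fin m → Finset S) :
    Joint (heldQubits E) ≃ ((i : Fin m) → ({a // a ∈ E i} → Fin 2)) where
  toFun x i a := x a.1 ⟨i, a.2⟩
  invFun z a i := z i.1 ⟨a, i.2⟩

/-- The local operators on the held qubits that consist of one operator for each qubit. -/
noncomputable def qubitwise (U : (i : Fin m) → {a // a ∈ E i} → Matrix (Fin 2) (Fin 2) ℂ) (a : S) :
    Matrix (heldQubits E a).Label (heldQubits E a).Label ℂ :=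
  tensorOp (d := fun _ : {i // a ∈ E i} => qubit) (d' := fun _ : {i // a ∈ E i} => qubit)
    fun i => U i.1 ⟨a, i.2⟩

theorem qubitwise_isometry {U : (i : Fin m) → {a // a ∈ E i} → Matrix (Fin 2) (Fin 2) ℂ}
    (hU : ∀ i a, (U i a)ᴴ * U i a = 1) (a : S) : (qubitwise U a)ᴴ * qubitwise U a = 1 :=
  tensorOp_isometry (d := fun _ : {i // a ∈ E i} => qubit)
    (d' := fun _ : {i // a ∈ E i} => qubit) fun i => hU i.1 ⟨a, i.2⟩

variable [Fintype S]

theorem sum_prod_hyperedges {R : Type} [CommSemiring R] (E : Fin m → Finset S)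
    (F : (i : Fin m) → ({a // a ∈ E i} → Fin 2) → R) :
    ∑ x : Joint (heldQubits E), ∏ i, F i (fun a => x a.1 ⟨i, a.2⟩) = ∏ i, ∑ z, F i z := by
  rw [Finset.prod_univ_sum, Fintype.piFinset_univ]
  exact Fintype.sum_equiv (regroupQubits E) _ _ fun x => rfl

theorem tensorOp_qubitwise_mulVec
    (U : (i : Fin m) → {a // a ∈ E i} → Matrix (Fin 2) (Fin 2) ℂ)
    (φ : (i : Fin m) → ({a // a ∈ E i} → Fin 2) → ℂ) :
    tensorOp (qubitwise U) *ᵥ hypergraphState E φ = hypergraphState E fun i =>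
      tensorOp (d := fun _ : {a // a ∈ E i} => qubit) (d' := fun _ : {a // a ∈ E i} => qubit)
        (U i) *ᵥ φ i := by
  ext x
  have h := sum_prod_hyperedges E fun i z =>
    (∏ a : {a // a ∈ E i}, U i a (x a.1 ⟨i, a.2⟩) (z a)) * φ i z
  simp only [hypergraphState, Matrix.mulVec, dotProduct, tensorOp, qubitwise, Matrix.of_apply]
  refine Eq.trans (Finset.sum_congr rfl fun y _ => ?_) h
  rw [Finset.prod_mul_distrib]
  congr 1
  -- Padding with 1 off the incidences turns both products into products over all pairs of agent and
  -- hyperedge, whose order can then be exchanged.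
  have h1 : ∀ i, ∏ a : {a // a ∈ E i}, U i a (x a.1 ⟨i, a.2⟩) (y a.1 ⟨i, a.2⟩) =
      ∏ a : S, if h : a ∈ E i then U i ⟨a, h⟩ (x a ⟨i, h⟩) (y a ⟨i, h⟩) else 1 := by
    intro i
    rw [Finset.prod_dite]
    simp only [Finset.prod_const_one, mul_one]
    refine Finset.prod_bij' (fun a _ => ⟨a.1, by simp [a.2]⟩)
      (fun a _ => ⟨a.1, (Finset.mem_filter.1 a.2).2⟩) ?_ ?_ ?_ ?_ ?_ <;> simp
  have h2 : ∀ a : S, ∏ i : {i // a ∈ E i}, U i.1 ⟨a, i.2⟩ (x a i) (y a i) =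
      ∏ i : Fin m, if h : a ∈ E i then U i ⟨a, h⟩ (x a ⟨i, h⟩) (y a ⟨i, h⟩) else 1 := by
    intro a
    rw [Finset.prod_dite]
    simp only [Finset.prod_const_one, mul_one]
    refine Finset.prod_bij' (fun a _ => ⟨a.1, by simp [a.2]⟩)
      (fun a _ => ⟨a.1, (Finset.mem_filter.1 a.2).2⟩) ?_ ?_ ?_ ?_ ?_ <;> simp
  rw [Finset.prod_congr rfl fun i _ => h1 i]
  refine (Finset.prod_congr rfl fun a _ => h2 a).trans ?_
  exact Finset.prod_comm

theorem trace_pureDensity_hypergraphState {φ : (i : Fin m) → ({a // a ∈ E i} → Fin 2) → ℂ}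
    (hφ : ∀ i, (pureDensity (φ i)).trace = 1) :
    (pureDensity (hypergraphState E φ)).trace = 1 := by
  have h := sum_prod_hyperedges E fun i z => φ i z * star (φ i z)
  rw [trace_pureDensity, dotProduct]
  refine Eq.trans (Finset.sum_congr rfl fun x _ => ?_) (h.trans (Finset.prod_eq_one fun i _ => ?_))
  · simp [hypergraphState, Finset.prod_mul_distrib]
  · rw [← hφ i, trace_pureDensity]
    rfl

/-- An entangled hypergraph of GHZ states is a superposition over one bit for each hyperedge. -/
theorem hypergraphState_ghz (x : Joint (heldQubits E)) :
    hypergraphState E (fun i => ghz {a // a ∈ E i}) x =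
      ∑ c : Fin m → Fin 2, (1 / (Real.sqrt 2 : ℂ)) ^ m *
        if x = (fun _ i => c i.1) then 1 else 0 := by
  simp only [hypergraphState, ghz_apply]
  rw [Finset.prod_univ_sum, Fintype.piFinset_univ]
  refine Finset.sum_congr rfl fun c _ => ?_
  rw [Finset.prod_mul_distrib, Finset.prod_const, Finset.card_univ, Fintype.card_fin,
    Finset.prod_boole]
  congr 1
  refine @if_congr _ _ _ (_) (_) _ _ _ _ ?_ rfl rfl
  simp only [Finset.mem_univ, true_imp_iff, funext_iff]
  exact ⟨fun h a i => h i.1 ⟨a, i.2⟩, fun h i a => h a.1 ⟨i, a.2⟩⟩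

end HypergraphState

/-! ### Sufficiency: parity measurements and corrections. -/

section Parity

variable {S : Type} [DecidableEq S] {m : ℕ} {E : Fin m → Finset S}

/-- In a connected hypergraph, labels of the vertices and of the hyperedges that agree at each
incidence are constant. -/
theorem HypergraphConnected.exists_const {R : Type} (hE : HypergraphConnected E) [Nonempty S]
    (hne : ∀ i, (E i).Nonempty) {f : S → R} {g : Fin m → R} (h : ∀ i, ∀ a ∈ E i, g i = f a) :
    ∃ r, (∀ a, f a = r) ∧ ∀ i, g i = r := by
  obtain ⟨a₀⟩ := ‹Nonempty S›
  have hf : ∀ b, f b = f a₀ := by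
    intro b
    obtain ⟨j, e, he, ha, hb⟩ := hE a₀ b
    have hg : ∀ k : Fin (j + 1), g (e k) = f a₀ := by
      intro k
      induction k using Fin.induction with
      | zero => exact h _ _ ha
      | succ k ih =>
        obtain ⟨c, hc⟩ := he k
        rw [Finset.mem_inter] at hc
        rw [h _ _ hc.2, ← h _ _ hc.1, ih]
    rw [← h _ _ hb, hg]
  refine ⟨f a₀, hf, fun i => ?_⟩
  obtain ⟨a, ha⟩ := hne i
  rw [h i a ha, hf]

/-- The Kraus operator of the outcome `s` of the parity measurement of an agent: it encodes the
basis states `s` and its complement into a single qubit. -/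
noncomputable def parityKraus (E : Fin m → Finset S) (a : S) (s : (heldQubits E a).Label) :
    Matrix (Fin 2) (heldQubits E a).Label ℂ :=
  Matrix.of fun b x => if x = (fun i => s i + b) then 1 / (Real.sqrt 2 : ℂ) else 0

/-- For each bit `b`, a basis state arises from exactly one `s` and contributes 1/2; the two bits
together give 1. -/
theorem sum_parityKraus (a : S) :
    ∑ s, (parityKraus E a s)ᴴ * parityKraus E a s = 1 := by
  ext x y
  simp only [Matrix.sum_apply, Matrix.mul_apply, Matrix.conjTranspose_apply, parityKraus,
    Matrix.of_apply]
  rw [Finset.sum_comm]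
  have hinv : ∀ (b : Fin 2) (x s : (heldQubits E a).Label),
      x = (fun i => s i + b) ↔ s = fun i => x i - b := by
    intro b x s
    constructor
    · rintro rfl
      simp
    · rintro rfl
      simp
  have hb : ∀ b : Fin 2, ∑ s : (heldQubits E a).Label,
      star (if x = (fun i => s i + b) then 1 / (Real.sqrt 2 : ℂ) else 0) *
        (if y = (fun i => s i + b) then 1 / (Real.sqrt 2 : ℂ) else 0) =
        if x = y then 1 / 2 else 0 := by
    intro b
    rw [Finset.sum_eq_single fun i => x i - b]
    · have hs : star (1 / (Real.sqrt 2 : ℂ)) = 1 / (Real.sqrt 2 : ℂ) := by simp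
      simp only [sub_add_cancel]
      by_cases hxy : x = y
      · subst hxy
        simp only [if_true, hs, inv_sqrt_two_mul_self]
      · rw [if_neg (c := y = _) fun h => hxy h.symm, mul_zero, if_neg hxy]
    · intro s _ hs
      rw [if_neg fun h => hs ((hinv b x s).1 h), star_zero, zero_mul]
    · simp
  simp only [hb, Finset.sum_const, Finset.card_univ, Fintype.card_fin, Matrix.one_apply]
  by_cases hxy : x = y <;> simp [hxy]

/-- The parity measurement of an agent. -/
noncomputable def parityInstrument (E : Fin m → Finset S) (a : S) : Instrument (heldQubits E a) qubit where
  outcomes := Fintype.card (heldQubits E a).Label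
  env := 1
  kraus o _ := parityKraus E a ((Fintype.equivFin _).symm o)
  complete := by
    rw [← sum_parityKraus a]
    exact Fintype.sum_equiv (Fintype.equivFin _).symm _ _ fun o => Fintype.sum_unique _

variable [Fintype S]

/-- Up to a constant, the amplitude at `y` counts the hyperedge bit strings compatible with the
outcome `s` and the retained bits `y`. -/
theorem tensorOp_parityKraus_mulVec (s : Joint (heldQubits E)) (y : S → Fin 2) :
    (tensorOp (d' := fun _ => qubit) (fun a => parityKraus E a (s a)) *ᵥ
      hypergraphState E fun i => ghz {a // a ∈ E i}) y =
    ∑ c : Fin m → Fin 2, (1 / (Real.sqrt 2 : ℂ)) ^ Fintype.card S * (1 / (Real.sqrt 2 : ℂ)) ^ m *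
      if (fun _ i => c i.1 : Joint (heldQubits E)) = (fun a i => s a i + y a) then 1 else 0 := by
  have hK (x : Joint (heldQubits E)) :
      tensorOp (d' := fun _ => qubit) (fun a => parityKraus E a (s a)) y x =
        (1 / (Real.sqrt 2 : ℂ)) ^ Fintype.card S *
          if x = (fun a i => s a i + y a) then 1 else 0 := by
    have h1 : ∀ a, parityKraus E a (s a) (y a) (x a) = (1 / (Real.sqrt 2 : ℂ)) *
        if x a = (fun i => s a i + y a) then 1 else 0 := by
      exact fun _ => by simp [parityKraus]
    simp only [tensorOp, Matrix.of_apply, h1]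
    rw [Finset.prod_mul_distrib, Finset.prod_const, Finset.card_univ, Finset.prod_boole]
    congr 1
    refine @if_congr _ _ _ (_) (_) _ _ _ _ ?_ rfl rfl
    simp only [Finset.mem_univ, true_imp_iff, funext_iff]
  simp only [Matrix.mulVec, dotProduct, hypergraphState_ghz, hK, Finset.mul_sum]
  rw [Finset.sum_comm]
  refine Finset.sum_congr rfl fun c _ => ?_
  rw [Finset.sum_eq_single (fun a i => c i.1 : Joint (heldQubits E))]
  · rw [if_pos rfl]
    ring
  · intro x _ hx
    rw [if_neg hx, mul_zero, mul_zero]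
  · simp

/-- The matrix of the bit flip `X ^ t`. -/
noncomputable def bitFlip (t : Fin 2) : Matrix (Fin 2) (Fin 2) ℂ :=
  Matrix.of fun y x => if x = y + t then 1 else 0

theorem bitFlip_isometry (t : Fin 2) : (bitFlip t)ᴴ * bitFlip t = 1 := by
  ext i j
  fin_cases t <;> fin_cases i <;> fin_cases j <;>
    simp [bitFlip, Matrix.mul_apply, Matrix.conjTranspose_apply, Fin.sum_univ_two]

theorem tensorOp_bitFlip_mulVec (t : S → Fin 2) (v : (S → Fin 2) → ℂ) (y : S → Fin 2) :
    (tensorOp (d := fun _ : S => qubit) (d' := fun _ : S => qubit) (fun a => bitFlip (t a)) *ᵥ v)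
      y = v fun a => y a + t a := by
  simp only [Matrix.mulVec, dotProduct, tensorOp, Matrix.of_apply, bitFlip, Finset.prod_boole,
    Finset.mem_univ, true_imp_iff]
  rw [Finset.sum_eq_single fun a => y a + t a]
  · simp
  · intro x _ hx
    rw [if_neg fun h => hx (funext h), zero_mul]
  · simp

/-- After the parity measurements, suitable bit flips lead to a multiple of a GHZ state. -/
theorem exists_bitFlip_eq_smul_ghz [Nonempty S] (hE : HypergraphConnected E)
    (hne : ∀ i, (E i).Nonempty) (s : Joint (heldQubits E)) :
    ∃ (t : S → Fin 2) (k : ℂ),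
      tensorOp (d := fun _ : S => qubit) (d' := fun _ : S => qubit) (fun a => bitFlip (t a)) *ᵥ
        (tensorOp (d' := fun _ => qubit) (fun a => parityKraus E a (s a)) *ᵥ
          hypergraphState E fun i => ghz {a // a ∈ E i}) = k • ghz S := by
  -- If nothing is compatible with `s`, the outcome has amplitude zero and `k = 0` works. Otherwise
  -- any compatible `y` serves as the correction `t`.
  by_cases hs : ∃ (t : S → Fin 2) (c : Fin m → Fin 2),
      (fun a i => c i.1 : Joint (heldQubits E)) = fun a i => s a i + t a
  · obtain ⟨t, c₀, hc₀⟩ := hs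
    have h₀ : ∀ a (i : {i // a ∈ E i}), c₀ i.1 = s a i + t a :=
      fun a i => congrFun (congrFun hc₀ a) i
    refine ⟨t, (1 / (Real.sqrt 2 : ℂ)) ^ Fintype.card S * (1 / (Real.sqrt 2 : ℂ)) ^ m /
      (1 / (Real.sqrt 2 : ℂ)), funext fun y => ?_⟩
    rw [tensorOp_bitFlip_mulVec, tensorOp_parityKraus_mulVec, Pi.smul_apply, ghz_apply,
      ← Finset.mul_sum, ← Finset.mul_sum, smul_eq_mul, ← mul_assoc,
      div_mul_cancel₀ _ inv_sqrt_two_ne_zero]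
    congr 1
    -- Relative to the reference solution `c₀`, compatibility says that `c - c₀` and `y` agree at
    -- every incidence; by connectivity both are then the same constant.
    have hiff (c : Fin m → Fin 2) : ((fun a i => c i.1 : Joint (heldQubits E)) =
        fun a i => s a i + (y a + t a)) ↔ ∀ i, ∀ a ∈ E i, c i - c₀ i = y a := by
      simp only [funext_iff, Subtype.forall]
      constructor
      · intro h i a ha
        rw [h a i ha, h₀ a ⟨i, ha⟩]
        abel
      · intro h a i ha
        rw [← h i a ha, h₀ a ⟨i, ha⟩]
        abel
    simp only [hiff]
    by_cases hy : ∃ b : Fin 2, y = fun _ => b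
    · obtain ⟨b, rfl⟩ := hy
      rw [Finset.sum_eq_single fun i => c₀ i + b, Finset.sum_eq_single b]
      · simp
      · intro b' _ hb'
        rw [if_neg fun h => hb' (congrFun h (Classical.arbitrary S)).symm]
      · simp
      · intro c _ hc
        refine if_neg fun h => hc (funext fun i => ?_)
        obtain ⟨a, ha⟩ := hne i
        have hb : c i - c₀ i = b := h i a ha
        rw [← hb]
        abel
      · simp
    · rw [Finset.sum_eq_zero, Finset.sum_eq_zero]
      · intro b _
        exact if_neg fun h => hy ⟨b, h⟩
      · intro c _
        refine if_neg fun h => hy ?_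
        obtain ⟨r, hr, -⟩ := hE.exists_const hne h
        exact ⟨r, funext hr⟩
  · refine ⟨0, 0, funext fun y => ?_⟩
    rw [tensorOp_bitFlip_mulVec, tensorOp_parityKraus_mulVec, zero_smul, Pi.zero_apply]
    refine Finset.sum_eq_zero fun c _ => ?_
    rw [if_neg fun h => hs ⟨_, c, h⟩, mul_zero]

/-- A connected hypergraph of maximally entangled states can be turned into any maximally
entangled state: the agents undo the local bases, measure parities, and correct bit flips. -/
theorem canPrepare_of_connected [Nonempty S] (hE : HypergraphConnected E)
    (hne : ∀ i, (E i).Nonempty) {φ : (i : Fin m) → ({a // a ∈ E i} → Fin 2) → ℂ}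
    (hφ : ∀ i, IsMaxEntangled (φ i)) {ψ : (S → Fin 2) → ℂ} (hψ : IsMaxEntangled ψ) :
    CanPrepare (e := fun _ : S => qubit) (hypergraphState E φ) ψ := by
  have hφ1 : (pureDensity (hypergraphState E φ)).trace = 1 :=
    trace_pureDensity_hypergraphState fun i =>
      haveI := (hne i).to_subtype
      trace_pureDensity_of_isMaxEntangled (hφ i)
  have hψ1 := trace_pureDensity_of_isMaxEntangled hψ
  choose U hU using hφ
  obtain ⟨V, hV⟩ := hψ
  choose t k htk using exists_bitFlip_eq_smul_ghz hE hne
  let W (i : Fin m) (a : {a // a ∈ E i}) : Matrix (Fin 2) (Fin 2) ℂ :=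
    (U i a : Matrix (Fin 2) (Fin 2) ℂ)ᴴ
  have hW : ∀ i a, (W i a)ᴴ * W i a = 1 := fun i a => by
    rw [Matrix.conjTranspose_conjTranspose, unitary_mul_conjTranspose_self]
  have hundo : tensorOp (qubitwise W) *ᵥ hypergraphState E φ =
      hypergraphState E fun i => ghz {a // a ∈ E i} := by
    rw [tensorOp_qubitwise_mulVec]
    congr 1
    funext i
    rw [hU i, Matrix.mulVec_mulVec, ← tensorOp_conjTranspose, tensorOp_isometry
      (d := fun _ : {a // a ∈ E i} => qubit) (d' := fun _ : {a // a ∈ E i} => qubit)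
      fun a => unitary_conjTranspose_mul_self (U i a), Matrix.one_mulVec]
  let label (o : (a : S) → Fin (parityInstrument E a).outcomes) : Joint (heldQubits E) :=
    fun a => (Fintype.equivFin _).symm (o a)
  let C (s : Joint (heldQubits E)) (a : S) : Matrix (Fin 2) (Fin 2) ℂ :=
    (V a : Matrix (Fin 2) (Fin 2) ℂ) * bitFlip (t s a)
  have hC : ∀ s a, (C s a)ᴴ * C s a = 1 := fun s a => by
    rw [Matrix.conjTranspose_mul, Matrix.mul_assoc, ← Matrix.mul_assoc _ (V a).1,
      unitary_conjTranspose_mul_self, Matrix.one_mul, bitFlip_isometry]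
  let P : LOCC (fun _ : S => qubit) (heldQubits E) :=
    LOCC.isometryThen (d' := heldQubits E) (qubitwise W) (qubitwise_isometry hW)
      (LOCC.round (parityInstrument E) fun o =>
        LOCC.isometryThen (d := fun _ => qubit) (d' := fun _ => qubit) (C (label o))
          (hC (label o)) LOCC.done)
  have hrun : P.run (pureDensity (hypergraphState E φ)) =
      (∑ o, k (label o) * star (k (label o))) • pureDensity ψ := by
    rw [LOCC.run_isometryThen, hundo, LOCC.run, Finset.sum_smul]
    refine Finset.sum_congr rfl fun o _ => ?_
    have hround : roundState (parityInstrument E) o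
        (pureDensity (hypergraphState E fun i => ghz {a // a ∈ E i})) =
        pureDensity (tensorOp (d' := fun _ => qubit) (fun a => parityKraus E a (label o a)) *ᵥ
          hypergraphState E fun i => ghz {a // a ∈ E i}) := by
      rw [← mul_pureDensity_mul_conjTranspose]
      exact Fintype.sum_unique (ι := (a : S) → Fin 1) _
    rw [hround, LOCC.run_isometryThen, LOCC.run]
    have hCo := tensorOp_mul (d := fun _ : S => qubit) (d' := fun _ : S => qubit)
      (d'' := fun _ : S => qubit) (fun a => (V a : Matrix (Fin 2) (Fin 2) ℂ))
      fun a => bitFlip (t (label o) a)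
    rw [← hCo, ← Matrix.mulVec_mulVec, htk, Matrix.mulVec_smul, ← hV, pureDensity_smul]
  -- Every branch ends in a multiple of the target; comparing traces shows that the total weight is
  -- 1.
  have htr := P.trace_run (pureDensity (hypergraphState E φ))
  rw [hrun, Matrix.trace_smul, hφ1] at htr
  have hsum : ∑ o, k (label o) * star (k (label o)) = 1 := by
    rw [← htr, hψ1]
    simp
  exact ⟨P, by rw [hrun, hsum, one_smul]⟩

end Parity

theorem theorem5 (n m : ℕ) (hn : 2 ≤ n)
    (E : Fin m → Finset (Fin n)) (hE : ∀ i, (E i).Nonempty)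
    (φ : (i : Fin m) → ({a // a ∈ E i} → Fin 2) → ℂ) (hφ : ∀ i, IsMaxEntangled (φ i))
    (ψ : (Fin n → Fin 2) → ℂ) (hψ : IsMaxEntangled ψ) :
    CanPrepare (e := fun _ : Fin n => qubit) (hypergraphState E φ) ψ ↔
      HypergraphConnected E := by
  have : Nontrivial (Fin n) := Fin.nontrivial_iff_two_le.2 hn
  refine ⟨fun h => ?_, fun h => canPrepare_of_connected h hE hφ hψ⟩
  by_contra hcon
  obtain ⟨A, a, b, ha, hb, hA⟩ := exists_cut_of_not_connected hcon
  exact hψ.not_isCutProduct ha hb (h.isCutProduct (isCutProduct_hypergraphState hA φ))
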